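/- Let $X\in\mathbb{R}^n$ and $\varepsilon\in\mathbb{R}^m$ be independent random vectors with $X\sim\mathcal{N}(0,\Gamma_X)$ and $\varepsilon\sim\mathcal{N}(0,\Gamma_{Y|X})$, where $\Gamma_X$ and $\Gamma_{Y|X}$ are symmetric positive definite ($\Gamma_{Y|X}$ need not be diagonal). Let $G\in\mathbb{R}^{m\times n}$, $Y=GX+\varepsilon$, and $\Gamma_Y=G\Gamma_XG^\top+\Gamma_{Y|X}$. Denote by $\mathcal{I}(X;Z)=D_{\mathrm{KL}}(\pi_{X,Z}\,\|\,\pi_X\pi_Z)$ the mutual information (in nats), by $\log A$ the matrix logarithm of a symmetric positive definite matrix $A$, and by $\operatorname{diag}(A)$ the diagonal matrix with the same diagonal as $A$. Let $\mathcal{P}=[e_{i_1},\dots,e_{i_k}]\in\mathbb{R}^{m\times k}$ be a selection operator, that is, $e_{i_1},\dots,e_{i_k}$ are distinct canonical unit vectors of $\mathbb{R}^m$. Let $\mathcal{P}^c$ be a complementary selection operator, whose columns are the remaining $m-k$ canonical unit vectors. Put $Y_{\mathcal{P}}=\mathcal{P}^\top Y$, let $Y\setminus Y_{\mathcal{P}}=(\mathcal{P}^c)^\top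 Y$ be the observations that are not selected, and for a selection operator $\mathcal{Q}$ put $$\mathfrak{D}_{\mathcal{Q}}=\tfrac12\operatorname{tr}\bigl(\mathcal{Q}^\top(\log\operatorname{diag}(\Gamma_{Y|X})-\log\Gamma_{Y|X})\mathcal{Q}\bigr).$$ Then $\mathcal{I}(X;Y)$, $\mathcal{I}(X;Y_{\mathcal{P}})$ and $\mathcal{I}(X;Y\setminus Y_{\mathcal{P}})$ are finite, $$\mathcal{I}(X;Y)-\mathcal{I}(X;Y\setminus Y_{\mathcal{P}})\le\tfrac12\operatorname{tr}\bigl(\mathcal{P}^\top(\log\Gamma_Y-\log\Gamma_{Y|X})\mathcal{P}\bigr)+\mathfrak{D}_{\mathcal{P}^c},\tag{1}$$ and $$\mathcal{I}(X;Y_{\mathcal{P}})\ge\tfrac12\operatorname{tr}\bigl(\mathcal{P}^\top(\log\Gamma_Y-\log\Gamma_{Y|X})\mathcal{P}\bigr)-\mathfrak{D}_{\mathcal{P}}.\tag{2}$$ Moreover, (1) for $\mathcal{P}$ is equivalent to (2) for $\mathcal{P}^c$. -/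

import Mathlib

open MeasureTheory ProbabilityTheory
open scoped Matrix ENNReal

noncomputable section

namespace LinearGaussianDesign

/-- Mutual information: the Kullback-Leibler divergence of the joint law of `(X, Z)` from the
product of its marginals, with values in `[0, ∞]` (in nats). -/
def mutualInfo {Ω E F : Type*} [MeasurableSpace Ω] [MeasurableSpace E] [MeasurableSpace F]
    (μ : Measure Ω) (X : Ω → E) (Z : Ω → F) : ℝ≥0∞ :=
  InformationTheory.klDiv (μ.map fun ω => (X ω, Z ω)) ((μ.map X).prod (μ.map Z))

/-- The selection operator `[e_{i 0}, …, e_{i (k-1)}]`, an `m × k` matrix whose columns are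
distinct canonical unit vectors. Its index set is `Set.range i`. -/
def selectionOperator {m k : ℕ} (i : Fin k ↪ Fin m) : Matrix (Fin m) (Fin k) ℝ :=
  Matrix.of fun a j => if a = i j then 1 else 0

/-- The selected observations `Pᵀ Y`. -/
def select {Ω : Type*} {m k : ℕ} (P : Matrix (Fin m) (Fin k) ℝ)
    (Y : Ω → EuclideanSpace ℝ (Fin m)) : Ω → EuclideanSpace ℝ (Fin k) :=
  fun ω => Matrix.toEuclideanLin Pᵀ (Y ω)

/-- The marginal covariance `G Γ_X Gᵀ + Γ_{Y|X}` of the data `Y = G X + ε`. -/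
def dataCov {m n : ℕ} (G : Matrix (Fin m) (Fin n) ℝ) (ΓX : Matrix (Fin n) (Fin n) ℝ)
    (ΓYX : Matrix (Fin m) (Fin m) ℝ) : Matrix (Fin m) (Fin m) ℝ :=
  G * ΓX * Gᵀ + ΓYX

/-- The matrix logarithm of a symmetric positive definite matrix, through the continuous
functional calculus: the logarithm is applied to the eigenvalues. -/
def matLog {m : ℕ} (A : Matrix (Fin m) (Fin m) ℝ) : Matrix (Fin m) (Fin m) ℝ :=
  cfc Real.log A

/-- `½ tr (Pᵀ (log A - log B) P)`. -/
def halfTraceLog {m k : ℕ} (P : Matrix (Fin m) (Fin k) ℝ) (A B : Matrix (Fin m) (Fin m) ℝ) : ℝ :=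
  1 / 2 * (Pᵀ * (matLog A - matLog B) * P).trace

/-- The deviation term `½ tr (Pᵀ (log diag Γ_{Y|X} - log Γ_{Y|X}) P)`, where `diag Γ` is the
diagonal matrix with the same diagonal as `Γ`. -/
def deviation {m k : ℕ} (P : Matrix (Fin m) (Fin k) ℝ) (ΓYX : Matrix (Fin m) (Fin m) ℝ) : ℝ :=
  halfTraceLog P (Matrix.diagonal ΓYX.diag) ΓYX

end LinearGaussianDesign

end

/-! ### Trace inequalities for the matrix logarithm -/

namespace LinearGaussianDesign

open Matrix

variable {m k : ℕ}

/-! If `Qᵀ * Q = 1`, the compressed data `Qᵀ Y` see `X` through additive Gaussian noise, so their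
mutual information with `X` is `½ (log det (Qᵀ Γ_Y Q) - log det (Qᵀ Γ_{Y|X} Q))`
(`mutualInfo_select`). The cases `Q = 1, P, Pc` turn the theorem into matrix analysis. For (2), the
first determinant is bounded below by `tr (Qᵀ log Γ_Y Q)`, which is Jensen's inequality for the
concave logarithm (`trace_matLog_le_log_det`). The second is bounded above by the product of the
diagonal entries (`log_det_le_sum_log_diag`); the deviation term pays for replacing `log Γ_{Y|X}` by
`log diag Γ_{Y|X}`. For (1), the half traces over `P` and `Pc` add up to the information in all of
`Y` (`halfTraceLog_add_compl`), so (1) for `P` is a rearrangement of (2) for `Pc`. -/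

/-- The quadratic form of `f(A)` in terms of the spectral decomposition of `A`. -/
lemma dotProduct_cfc_mulVec {A : Matrix (Fin m) (Fin m) ℝ} (hA : A.IsHermitian) (f : ℝ → ℝ)
    (u : Fin m → ℝ) :
    u ⬝ᵥ (cfc f A *ᵥ u) =
      ∑ i, ((star (hA.eigenvectorUnitary : Matrix (Fin m) (Fin m) ℝ)) *ᵥ u) i ^ 2 *
        f (hA.eigenvalues i) := by
  rw [hA.cfc_eq, IsHermitian.cfc, Unitary.conjStarAlgAut_apply, ← mulVec_mulVec, ← mulVec_mulVec,
    dotProduct_mulVec, star_eq_conjTranspose, conjTranspose_eq_transpose_of_trivial,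
    mulVec_transpose]
  simp only [dotProduct, mulVec_diagonal, Function.comp_apply, RCLike.ofReal_real_eq_id, id_eq]
  exact Finset.sum_congr rfl fun i _ => by ring

lemma sum_sq_eigenvectorUnitary_mulVec {A : Matrix (Fin m) (Fin m) ℝ} (hA : A.IsHermitian)
    (u : Fin m → ℝ) :
    ∑ i, ((star (hA.eigenvectorUnitary : Matrix (Fin m) (Fin m) ℝ)) *ᵥ u) i ^ 2 = u ⬝ᵥ u := by
  have h := dotProduct_cfc_mulVec hA (fun _ => 1) u
  rw [cfc_const_one ℝ A (by exact hA)] at h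
  simpa using h.symm

/-- Jensen's inequality for the matrix logarithm. -/
lemma dotProduct_matLog_mulVec_le {A : Matrix (Fin m) (Fin m) ℝ} (hA : A.PosDef)
    {u : Fin m → ℝ} (hu : u ⬝ᵥ u = 1) :
    u ⬝ᵥ (matLog A *ᵥ u) ≤ Real.log (u ⬝ᵥ (A *ᵥ u)) := by
  have h1 := dotProduct_cfc_mulVec hA.1 id u
  rw [cfc_id ℝ A (by exact hA.1)] at h1
  rw [matLog, dotProduct_cfc_mulVec hA.1, h1]
  have h := strictConcaveOn_log_Ioi.concaveOn.le_map_sum (t := Finset.univ)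
    (w := fun i => ((star (hA.1.eigenvectorUnitary : Matrix (Fin m) (Fin m) ℝ)) *ᵥ u) i ^ 2)
    (p := hA.1.eigenvalues) (fun i _ => sq_nonneg _)
    ((sum_sq_eigenvectorUnitary_mulVec hA.1 u).trans hu) (fun i _ => hA.eigenvalues_pos i)
  simpa using h

lemma trace_matLog {A : Matrix (Fin m) (Fin m) ℝ} (hA : A.PosDef) :
    (matLog A).trace = Real.log A.det := by
  rw [matLog, hA.1.cfc_eq, IsHermitian.cfc, Unitary.conjStarAlgAut_apply, Matrix.trace_mul_comm,
    ← mul_assoc, hA.1.det_eq_prod_eigenvalues]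
  simp only [RCLike.ofReal_real_eq_id, id_eq]
  rw [Real.log_prod fun i _ => (hA.eigenvalues_pos i).ne']
  simp [Matrix.trace]

lemma transpose_mul_mul_apply {k : ℕ} (Q : Matrix (Fin m) (Fin k) ℝ)
    (A : Matrix (Fin m) (Fin m) ℝ) (j : Fin k) :
    (Qᵀ * A * Q) j j = Q.col j ⬝ᵥ (A *ᵥ Q.col j) := by
  rw [Matrix.mul_assoc, mul_apply]
  simp [dotProduct, mulVec, mul_apply, Matrix.col]

lemma posDef_transpose_mul_mul {A : Matrix (Fin m) (Fin m) ℝ} (hA : A.PosDef)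
    {Q : Matrix (Fin m) (Fin k) ℝ} (hQ : Qᵀ * Q = 1) : (Qᵀ * A * Q).PosDef := by
  have := hA.conjTranspose_mul_mul_same (B := Q) (by
    refine Function.LeftInverse.injective (g := fun v => Qᵀ *ᵥ v) fun v => ?_
    simp [mulVec_mulVec, hQ])
  rwa [conjTranspose_eq_transpose_of_trivial] at this

/-- Hadamard's inequality. -/
lemma log_det_le_sum_log_diag {A : Matrix (Fin m) (Fin m) ℝ} (hA : A.PosDef) :
    Real.log A.det ≤ ∑ j, Real.log (A j j) := by
  rw [← trace_matLog hA]
  refine Finset.sum_le_sum fun j _ => ?_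
  -- Jensen at a canonical unit vector bounds one diagonal entry of `log A`.
  have h := dotProduct_matLog_mulVec_le hA (u := Pi.single j 1) (by simp)
  simpa using h

/-- Compression to the range of an isometry: `tr (Qᵀ log A Q) ≤ log det (Qᵀ A Q)`. -/
lemma trace_matLog_le_log_det {A : Matrix (Fin m) (Fin m) ℝ} (hA : A.PosDef)
    {Q : Matrix (Fin m) (Fin k) ℝ} (hQ : Qᵀ * Q = 1) :
    (Qᵀ * matLog A * Q).trace ≤ Real.log (Qᵀ * A * Q).det := by
  have hB := posDef_transpose_mul_mul hA hQ
  -- Replacing `Q` by `Q * U` keeps the trace and makes the compression of `A` diagonal. Jensen on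
  -- each column of `Q * U` then yields the logarithm of one eigenvalue, and these sum to the
  -- log-determinant.
  set U : Matrix (Fin k) (Fin k) ℝ := (hB.1.eigenvectorUnitary : Matrix (Fin k) (Fin k) ℝ) with hU
  have hUU : Uᵀ * U = 1 := by
    have := Unitary.coe_star_mul_self hB.1.eigenvectorUnitary
    rwa [star_eq_conjTranspose, conjTranspose_eq_transpose_of_trivial] at this
  have hUU' : U * Uᵀ = 1 := mul_eq_one_comm.mp hUU
  have hR : (Q * U)ᵀ * (Q * U) = 1 := by
    rw [transpose_mul, Matrix.mul_assoc, ← Matrix.mul_assoc Qᵀ, hQ, Matrix.one_mul, hUU]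
  have htr : (Qᵀ * matLog A * Q).trace = ((Q * U)ᵀ * matLog A * (Q * U)).trace := by
    rw [show (Q * U)ᵀ * matLog A * (Q * U) = Uᵀ * ((Qᵀ * matLog A * Q) * U) by
      simp only [transpose_mul, Matrix.mul_assoc], trace_mul_comm Uᵀ, Matrix.mul_assoc _ U, hUU',
      Matrix.mul_one]
  have hdiag : (Q * U)ᵀ * A * (Q * U) = diagonal hB.1.eigenvalues := by
    have h := hB.1.conjStarAlgAut_star_eigenvectorUnitary
    rw [Unitary.conjStarAlgAut_apply] at h
    simp only [Unitary.coe_star, ← hU, star_eq_conjTranspose,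
      conjTranspose_eq_transpose_of_trivial, transpose_transpose] at h
    rw [transpose_mul]
    simpa only [Matrix.mul_assoc, RCLike.ofReal_real_eq_id, Function.id_comp] using h
  rw [htr, hB.1.det_eq_prod_eigenvalues]
  simp only [RCLike.ofReal_real_eq_id, id_eq]
  rw [Real.log_prod fun i _ => (hB.eigenvalues_pos i).ne']
  refine Finset.sum_le_sum fun j _ => ?_
  rw [diag_apply, transpose_mul_mul_apply]
  have hu : (Q * U).col j ⬝ᵥ (Q * U).col j = 1 := by
    have h := transpose_mul_mul_apply (Q * U) 1 j
    rw [Matrix.mul_one, hR] at h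
    simpa using h.symm
  refine (dotProduct_matLog_mulVec_le hA hu).trans_eq ?_
  rw [← transpose_mul_mul_apply, hdiag, diagonal_apply_eq]

/-- On the finite spectrum, `log` agrees with an interpolating polynomial, and polynomials commute
with the algebra homomorphism `diagonal`. -/
lemma matLog_diagonal (d : Fin m → ℝ) :
    matLog (diagonal d) = diagonal fun i => Real.log (d i) := by
  let p := Lagrange.interpolate (Finset.univ.image d) id Real.log
  have hp (i : Fin m) : p.eval (d i) = Real.log (d i) :=
    Lagrange.eval_interpolate_at_node (v := id) Real.log Function.injective_id.injOn
      (Finset.mem_image_of_mem d (Finset.mem_univ i))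
  have hD : (diagonal d).IsHermitian := isHermitian_diagonal d
  have h : matLog (diagonal d) = cfc p.eval (diagonal d) := by
    refine cfc_congr fun x hx => ?_
    rw [spectrum_diagonal] at hx
    obtain ⟨i, rfl⟩ := hx
    exact (hp i).symm
  rw [h, cfc_polynomial p _ (by exact hD), ← diagonalAlgHom_apply (R := ℝ),
    Polynomial.aeval_algHom_apply, diagonalAlgHom_apply]
  congr 1
  ext i
  rw [Polynomial.aeval_pi_apply₂, Polynomial.coe_aeval_eq_eval, hp i]

lemma selectionOperator_col (i : Fin k ↪ Fin m) (j : Fin k) :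
    (selectionOperator i).col j = Pi.single (i j) 1 := by
  ext a
  simp [selectionOperator, Matrix.col, Pi.single_apply]

lemma transpose_selectionOperator_mul_mul_apply (i : Fin k ↪ Fin m)
    (A : Matrix (Fin m) (Fin m) ℝ) (j : Fin k) :
    ((selectionOperator i)ᵀ * A * selectionOperator i) j j = A (i j) (i j) := by
  rw [transpose_mul_mul_apply, selectionOperator_col]
  simp

lemma transpose_selectionOperator_mul_self (i : Fin k ↪ Fin m) :
    (selectionOperator i)ᵀ * selectionOperator i = 1 := by
  ext a b
  simp [selectionOperator, mul_apply, one_apply, eq_comm]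

lemma trace_selectionOperator (i : Fin k ↪ Fin m) (A : Matrix (Fin m) (Fin m) ℝ) :
    ((selectionOperator i)ᵀ * A * selectionOperator i).trace = ∑ j, A (i j) (i j) :=
  Finset.sum_congr rfl fun j _ => transpose_selectionOperator_mul_mul_apply i A j

lemma trace_selectionOperator_add_compl {l : ℕ} (i : Fin k ↪ Fin m) (c : Fin l ↪ Fin m)
    (hc : IsCompl (Set.range i) (Set.range c)) (A : Matrix (Fin m) (Fin m) ℝ) :
    ((selectionOperator i)ᵀ * A * selectionOperator i).trace +
      ((selectionOperator c)ᵀ * A * selectionOperator c).trace = A.trace := by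
  rw [trace_selectionOperator, trace_selectionOperator, ← Fintype.sum_sumElim]
  have hb : Function.Bijective (Sum.elim i c) := by
    refine ⟨i.injective.sumElim c.injective fun a b h => ?_, fun a => ?_⟩
    · exact Set.disjoint_left.mp hc.disjoint ⟨a, rfl⟩ ⟨b, h.symm⟩
    · have : a ∈ Set.range i ∪ Set.range c := by
        rw [show Set.range i ∪ Set.range c = ⊤ from hc.sup_eq_top]; trivial
      rcases this with ⟨j, rfl⟩ | ⟨j, rfl⟩
      exacts [⟨.inl j, rfl⟩, ⟨.inr j, rfl⟩]
  rw [Matrix.trace, ← hb.sum_comp]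
  exact Finset.sum_congr rfl fun x _ => by cases x <;> rfl

end LinearGaussianDesign

/-! ### Gaussian densities and the information of an additive noise channel -/

namespace LinearGaussianDesign

open Matrix Real
open scoped RealInnerProductSpace MatrixOrder

lemma map_withDensity_comp {α β : Type*} [MeasurableSpace α] [MeasurableSpace β]
    (μ : Measure α) {S : α → β} (hS : Measurable S) {f : β → ℝ≥0∞} (hf : Measurable f) :
    (μ.withDensity fun x => f (S x)).map S = (μ.map S).withDensity f := by
  ext s hs
  rw [Measure.map_apply hS hs, withDensity_apply _ (hS hs), withDensity_apply _ hs,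
    setLIntegral_map hs hf hS]

/-- The measure with log-density `h` with respect to Lebesgue measure. -/
noncomputable def withLogDensity {k : ℕ} (h : EuclideanSpace ℝ (Fin k) → ℝ) :
    Measure (EuclideanSpace ℝ (Fin k)) :=
  volume.withDensity fun x => ENNReal.ofReal (rexp (h x))

/-- The log-density of the standard Gaussian measure. -/
noncomputable def stdLogDensity (k : ℕ) (x : EuclideanSpace ℝ (Fin k)) : ℝ :=
  -(1 / 2) * ‖x‖ ^ 2 - k / 2 * log (2 * π)

/-- Both measures are finite and have the same characteristic function, by the Gaussian Fourier
integral. -/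
lemma stdGaussian_eq_withLogDensity (k : ℕ) :
    stdGaussian (EuclideanSpace ℝ (Fin k)) = withLogDensity (stdLogDensity k) := by
  have hb : 0 < ((1 / 2 : ℂ)).re := by norm_num
  have hexp (x : EuclideanSpace ℝ (Fin k)) : ((rexp (stdLogDensity k x) : ℝ) : ℂ) =
      Complex.exp (-(1 / 2) * ‖x‖ ^ 2) * Complex.exp (-(k / 2 * log (2 * π) : ℝ)) := by
    rw [← Complex.exp_add, stdLogDensity, Complex.ofReal_exp]
    push_cast
    ring_nf
  have hint : Integrable fun x : EuclideanSpace ℝ (Fin k) => rexp (stdLogDensity k x) := by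
    have h := (GaussianFourier.integrable_cexp_neg_mul_sq_norm_add hb 0
      (0 : EuclideanSpace ℝ (Fin k))).mul_const (Complex.exp (-(k / 2 * log (2 * π) : ℝ)))
    refine h.re.congr (.of_forall fun x => ?_)
    simp only [zero_mul, add_zero]
    rw [← hexp]
    exact Complex.ofReal_re _
  have : IsFiniteMeasure (withLogDensity (stdLogDensity k)) :=
    isFiniteMeasure_withDensity_ofReal hint.2
  refine Measure.ext_of_charFun (funext fun t => ?_)
  have hmeas : Measurable fun x : EuclideanSpace ℝ (Fin k) =>
      ENNReal.ofReal (rexp (stdLogDensity k x)) := by unfold stdLogDensity; fun_prop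
  rw [charFun_stdGaussian, charFun_apply, withLogDensity,
    integral_withDensity_eq_integral_toReal_smul hmeas (by simp)]
  have h := GaussianFourier.integral_cexp_neg_mul_sq_norm_add hb Complex.I t
  have hcongr (x : EuclideanSpace ℝ (Fin k)) :
      (ENNReal.ofReal (rexp (stdLogDensity k x))).toReal • Complex.exp (⟪x, t⟫ * Complex.I) =
      Complex.exp (-(1 / 2) * ‖x‖ ^ 2 + Complex.I * ⟪t, x⟫) *
        Complex.exp (-(k / 2 * log (2 * π) : ℝ)) := by
    rw [ENNReal.toReal_ofReal (exp_pos _).le, Complex.real_smul, hexp, Complex.exp_add,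
      real_inner_comm, mul_comm Complex.I]
    ring
  simp_rw [hcongr]
  rw [integral_mul_const, h, finrank_euclideanSpace_fin,
    show (π : ℂ) / (1 / 2) = ((2 * π : ℝ) : ℂ) by push_cast; ring,
    Complex.cpow_def_of_ne_zero (by exact_mod_cast (by positivity : (2 * π : ℝ) ≠ 0)),
    ← Complex.ofReal_log (by positivity), ← Complex.exp_add, ← Complex.exp_add]
  congr 1
  push_cast
  rw [Complex.I_sq]
  ring

lemma integrable_stdLogDensity (k : ℕ) :
    Integrable (stdLogDensity k) (stdGaussian (EuclideanSpace ℝ (Fin k))) := by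
  have h : Integrable (fun x => ‖x‖ ^ 2) (stdGaussian (EuclideanSpace ℝ (Fin k))) :=
    (IsGaussian.memLp_two_id (μ := stdGaussian (EuclideanSpace ℝ (Fin k)))).integrable_norm_pow
      (by norm_num)
  exact (h.const_mul _).sub (integrable_const _)

/-- Log-density and differential entropy of a nondegenerate centered Gaussian measure. -/
lemma exists_logDensity_multivariateGaussian {k : ℕ} {S : Matrix (Fin k) (Fin k) ℝ}
    (hS : S.PosDef) :
    ∃ h : EuclideanSpace ℝ (Fin k) → ℝ, Measurable h ∧
      multivariateGaussian 0 S = withLogDensity h ∧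
      Integrable h (multivariateGaussian 0 S) ∧
      ∫ x, h x ∂(multivariateGaussian 0 S) =
        (∫ x, stdLogDensity k x ∂(stdGaussian (EuclideanSpace ℝ (Fin k)))) -
          1 / 2 * log S.det := by
  set R := CFC.sqrt S
  have hRdet : R.det = √S.det := by simpa using hS.posSemidef.det_sqrt
  have hRpos : 0 < R.det := hRdet ▸ sqrt_pos.mpr hS.det_pos
  let L : EuclideanSpace ℝ (Fin k) →L[ℝ] EuclideanSpace ℝ (Fin k) := toEuclideanCLM (𝕜 := ℝ) R
  let M : EuclideanSpace ℝ (Fin k) →L[ℝ] EuclideanSpace ℝ (Fin k) := toEuclideanCLM (𝕜 := ℝ) R⁻¹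
  have hML (x) : M (L x) = x := by
    have : M * L = 1 := by
      rw [← map_mul, nonsing_inv_mul _ hRpos.ne'.isUnit, map_one]
    exact congr($this x)
  have hmap : multivariateGaussian 0 S = (stdGaussian (EuclideanSpace ℝ (Fin k))).map L := by
    simp only [multivariateGaussian, zero_add]; rfl
  have hLdet : LinearMap.det (L : EuclideanSpace ℝ (Fin k) →ₗ[ℝ] EuclideanSpace ℝ (Fin k)) =
      R.det := by
    rw [coe_toEuclideanCLM_eq_toEuclideanLin, toEuclideanLin_eq_toLin_orthonormal,
      LinearMap.det_toLin]
  have hvol : (volume : Measure (EuclideanSpace ℝ (Fin k))).map L =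
      ENNReal.ofReal (R.det)⁻¹ • volume := by
    have := Measure.map_linearMap_addHaar_eq_smul_addHaar
      (volume : Measure (EuclideanSpace ℝ (Fin k))) (f := L) (by rw [hLdet]; exact hRpos.ne')
    rw [hLdet, abs_of_pos (inv_pos.mpr hRpos)] at this
    exact this
  have hstd : Measurable (stdLogDensity k) := by unfold stdLogDensity; fun_prop
  have hlog : rexp (-(1 / 2 * log S.det)) = (R.det)⁻¹ := by
    rw [hRdet, exp_neg, ← exp_log (sqrt_pos.mpr hS.det_pos), log_sqrt hS.det_pos.le]
    ring_nf
  -- Change of variables along `L`: the density is divided by `det R = √(det S)`, whence the term `½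
  -- log det S`.
  have hmeas : Measurable fun y => stdLogDensity k (M y) - 1 / 2 * log S.det := by fun_prop
  refine ⟨_, hmeas, ?_, ?_, ?_⟩
  · rw [hmap, stdGaussian_eq_withLogDensity, withLogDensity, withLogDensity]
    have h := map_withDensity_comp volume L.measurable
      (f := fun y => ENNReal.ofReal (rexp (stdLogDensity k (M y)))) (by fun_prop)
    simp only [hML] at h
    rw [h, hvol, withDensity_smul_measure, ← withDensity_smul _ (by fun_prop)]
    congr 1
    ext y
    rw [Pi.smul_apply, smul_eq_mul, ← ENNReal.ofReal_mul (inv_pos.mpr hRpos).le, sub_eq_add_neg,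
      exp_add, hlog, mul_comm]
  · rw [hmap, integrable_map_measure hmeas.aestronglyMeasurable (by fun_prop)]
    simp only [Function.comp_def, hML]
    exact (integrable_stdLogDensity k).sub (integrable_const _)
  · rw [hmap, integral_map (by fun_prop) hmeas.aestronglyMeasurable]
    simp only [hML]
    rw [integral_sub (integrable_stdLogDensity k) (integrable_const _)]
    simp

/-- Mutual information of an additive noise channel, as a difference of differential entropies. -/
lemma mutualInfo_add_noise {Ω E : Type*} [MeasurableSpace Ω] [MeasurableSpace E] {k : ℕ}
    (μ : Measure Ω) [IsProbabilityMeasure μ] {X : Ω → E} {η Z : Ω → EuclideanSpace ℝ (Fin k)}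
    (hX : AEMeasurable X μ) (hη : AEMeasurable η μ) (hind : IndepFun X η μ)
    {T : E → EuclideanSpace ℝ (Fin k)} (hT : Measurable T) (hZ : ∀ ω, Z ω = T (X ω) + η ω)
    {f g : EuclideanSpace ℝ (Fin k) → ℝ} (hf : Measurable f) (hg : Measurable g)
    (hηf : μ.map η = withLogDensity f) (hZg : μ.map Z = withLogDensity g)
    (hfi : Integrable f (μ.map η)) (hgi : Integrable g (μ.map Z)) :
    mutualInfo μ X Z ≠ ∞ ∧
      (mutualInfo μ X Z).toReal = ∫ y, f y ∂(μ.map η) - ∫ z, g z ∂(μ.map Z) := by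
  have hZm : AEMeasurable Z μ := by
    rw [show Z = fun ω => T (X ω) + η ω from funext hZ]; fun_prop
  have : IsProbabilityMeasure (μ.map X) := Measure.isProbabilityMeasure_map hX
  have : IsProbabilityMeasure (μ.map η) := Measure.isProbabilityMeasure_map hη
  have : IsProbabilityMeasure (μ.map Z) := Measure.isProbabilityMeasure_map hZm
  have hXZ : AEMeasurable (fun ω => (X ω, Z ω)) μ := hX.prodMk hZm
  have : IsProbabilityMeasure (μ.map fun ω => (X ω, Z ω)) := Measure.isProbabilityMeasure_map hXZ
  -- This shear carries `(X, η)` to `(X, Z)` and preserves `μ_X × volume` by translation invariance,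
  -- so the joint density is `f (z - T x)`.
  let S : E × EuclideanSpace ℝ (Fin k) → E × EuclideanSpace ℝ (Fin k) :=
    fun p => (p.1, T p.1 + p.2)
  have hS : MeasurePreserving S ((μ.map X).prod volume) ((μ.map X).prod volume) :=
    (MeasurePreserving.id (μ.map X)).skew_product (g := fun x y => T x + y)
      (by unfold Function.uncurry; fun_prop)
      (.of_forall fun x => (measurePreserving_add_left volume (T x)).map_eq)
  have hjoint : μ.map (fun ω => (X ω, Z ω)) = ((μ.map X).prod volume).withDensity
      fun p => ENNReal.ofReal (rexp (f (p.2 - T p.1))) := by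
    rw [show (fun ω => (X ω, Z ω)) = S ∘ fun ω => (X ω, η ω) from
      funext fun ω => Prod.ext rfl (hZ ω), ← AEMeasurable.map_map_of_aemeasurable
      hS.measurable.aemeasurable (hX.prodMk hη), hind.map_prod_eq_prod_map_map hX hη, hηf,
      withLogDensity, prod_withDensity_right (by fun_prop)]
    have h := map_withDensity_comp ((μ.map X).prod volume) hS.measurable
      (f := fun p => ENNReal.ofReal (rexp (f (p.2 - T p.1)))) (by fun_prop)
    rw [hS.map_eq] at h
    simpa [S] using h
  have hprod : (μ.map X).prod (μ.map Z) = ((μ.map X).prod volume).withDensity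
      fun p => ENNReal.ofReal (rexp (g p.2)) := by
    rw [hZg, withLogDensity, prod_withDensity_right (by fun_prop)]
  have hdens : μ.map (fun ω => (X ω, Z ω)) = ((μ.map X).prod (μ.map Z)).withDensity
      fun p => ENNReal.ofReal (rexp (f (p.2 - T p.1) - g p.2)) := by
    rw [hjoint, hprod, ← withDensity_mul _ (by fun_prop) (by fun_prop)]
    congr 1
    ext p
    rw [Pi.mul_apply, ← ENNReal.ofReal_mul (exp_pos _).le, ← exp_add, add_sub_cancel]
  have hac : μ.map (fun ω => (X ω, Z ω)) ≪ (μ.map X).prod (μ.map Z) :=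
    hdens ▸ withDensity_absolutelyContinuous _ _
  have hllr : llr (μ.map fun ω => (X ω, Z ω)) ((μ.map X).prod (μ.map Z))
      =ᵐ[μ.map fun ω => (X ω, Z ω)] fun p => f (p.2 - T p.1) - g p.2 := by
    refine hac.ae_le ?_
    have h := Measure.rnDeriv_withDensity ((μ.map X).prod (μ.map Z))
      (f := fun p => ENNReal.ofReal (rexp (f (p.2 - T p.1) - g p.2))) (by fun_prop)
    rw [← hdens] at h
    filter_upwards [h] with p hp
    rw [llr, hp, ENNReal.toReal_ofReal (exp_pos _).le, log_exp]
  have hcomp (ω : Ω) : f (Z ω - T (X ω)) - g (Z ω) = f (η ω) - g (Z ω) := by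
    rw [hZ, add_sub_cancel_left]
  have hfi' : Integrable (fun ω => f (η ω)) μ := hfi.comp_aemeasurable hη
  have hgi' : Integrable (fun ω => g (Z ω)) μ := hgi.comp_aemeasurable hZm
  have hint : Integrable (llr (μ.map fun ω => (X ω, Z ω)) ((μ.map X).prod (μ.map Z)))
      (μ.map fun ω => (X ω, Z ω)) := by
    rw [integrable_congr hllr, integrable_map_measure (by fun_prop) hXZ]
    simp only [Function.comp_def, hcomp]
    exact hfi'.sub hgi'
  refine ⟨InformationTheory.klDiv_ne_top hac hint, ?_⟩
  -- Both measures have mass one, so the divergence is the integral of the log-likelihood ratio with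
  -- no mass correction.
  rw [mutualInfo, InformationTheory.toReal_klDiv_of_measure_eq hac (by simp),
    integral_congr_ae hllr, integral_map hXZ (by fun_prop), integral_map hη (by fun_prop),
    integral_map hZm (by fun_prop)]
  simp only [hcomp]
  exact integral_sub hfi' hgi'

/-- Characteristic functions allow a singular image covariance, which is needed because `G * ΓX *
Gᵀ` may have no density. -/
lemma map_toEuclideanLin_multivariateGaussian {k m : ℕ} {S : Matrix (Fin m) (Fin m) ℝ}
    (hS : S.PosSemidef) (A : Matrix (Fin k) (Fin m) ℝ) :
    (multivariateGaussian 0 S).map (toEuclideanLin A) = multivariateGaussian 0 (A * S * Aᵀ) := by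
  have hA : Measurable (toEuclideanLin A : EuclideanSpace ℝ (Fin m) → EuclideanSpace ℝ (Fin k)) :=
    (LinearMap.continuous_of_finiteDimensional _).measurable
  have hASA : (A * S * Aᵀ).PosSemidef := by
    have := hS.mul_mul_conjTranspose_same A
    rwa [conjTranspose_eq_transpose_of_trivial] at this
  have : IsProbabilityMeasure ((multivariateGaussian 0 S).map (toEuclideanLin A)) :=
    Measure.isProbabilityMeasure_map hA.aemeasurable
  refine Measure.ext_of_charFun (funext fun t => ?_)
  have hinner (x : EuclideanSpace ℝ (Fin m)) :
      ⟪toEuclideanLin A x, t⟫ = ⟪x, toEuclideanLin Aᵀ t⟫ := by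
    simp only [EuclideanSpace.inner_eq_star_dotProduct, ofLp_toLpLin, toLin'_apply, star_trivial]
    rw [mulVec_transpose, dotProduct_mulVec]
  have h := charFun_multivariateGaussian (μ := 0) hS (toEuclideanLin Aᵀ t)
  rw [charFun_apply] at h
  rw [charFun_apply, integral_map hA.aemeasurable (by fun_prop)]
  simp only [hinner]
  rw [h, charFun_multivariateGaussian hASA]
  simp only [inner_zero_right, ofLp_toLpLin, toLin'_apply]
  rw [← mulVec_mulVec, ← mulVec_mulVec, mulVec_transpose, dotProduct_mulVec _ A]

lemma map_add_multivariateGaussian {Ω : Type*} [MeasurableSpace Ω] {μ : Measure Ω}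
    [IsProbabilityMeasure μ] {m : ℕ} {S R : Matrix (Fin m) (Fin m) ℝ}
    (hS : S.PosSemidef) (hR : R.PosSemidef) {U V : Ω → EuclideanSpace ℝ (Fin m)}
    (hU : HasLaw U (multivariateGaussian 0 S) μ) (hV : HasLaw V (multivariateGaussian 0 R) μ)
    (hUV : IndepFun U V μ) :
    HasLaw (fun ω => U ω + V ω) (multivariateGaussian 0 (S + R)) μ := by
  have hm : AEMeasurable (fun ω => U ω + V ω) μ := hU.aemeasurable.add hV.aemeasurable
  refine ⟨hm, ?_⟩
  have : IsProbabilityMeasure (μ.map fun ω => U ω + V ω) := Measure.isProbabilityMeasure_map hm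
  refine Measure.ext_of_charFun (funext fun t => ?_)
  rw [hUV.charFun_map_fun_add_eq_mul hU.aemeasurable hV.aemeasurable, Pi.mul_apply, hU.map_eq,
    hV.map_eq, charFun_multivariateGaussian hS, charFun_multivariateGaussian hR,
    charFun_multivariateGaussian (hS.add hR), ← Complex.exp_add, add_mulVec, dotProduct_add]
  congr 1
  push_cast
  simp only [inner_zero_right]
  push_cast
  ring

end LinearGaussianDesign

/-! ### Bounds for selected observations -/

namespace LinearGaussianDesign

open Matrix

variable {m n : ℕ}

lemma posDef_dataCov (G : Matrix (Fin m) (Fin n) ℝ) {ΓX : Matrix (Fin n) (Fin n) ℝ}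
    (hΓX : ΓX.PosDef) {ΓYX : Matrix (Fin m) (Fin m) ℝ} (hΓYX : ΓYX.PosDef) :
    (dataCov G ΓX ΓYX).PosDef := by
  have h := hΓX.posSemidef.mul_mul_conjTranspose_same G
  rw [conjTranspose_eq_transpose_of_trivial] at h
  exact hΓYX.posSemidef_add h

/-- Mutual information between the parameter and compressed data `Qᵀ Y`. -/
lemma mutualInfo_select {Ω : Type*} [MeasurableSpace Ω] (μ : Measure Ω) [IsProbabilityMeasure μ]
    (G : Matrix (Fin m) (Fin n) ℝ)
    {ΓX : Matrix (Fin n) (Fin n) ℝ} (hΓX : ΓX.PosDef)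
    {ΓYX : Matrix (Fin m) (Fin m) ℝ} (hΓYX : ΓYX.PosDef)
    {X : Ω → EuclideanSpace ℝ (Fin n)} {ε Y : Ω → EuclideanSpace ℝ (Fin m)}
    (hX : HasLaw X (multivariateGaussian 0 ΓX) μ)
    (hε : HasLaw ε (multivariateGaussian 0 ΓYX) μ)
    (hXε : IndepFun X ε μ)
    (hY : ∀ ω, Y ω = toEuclideanLin G (X ω) + ε ω)
    {k : ℕ} {Q : Matrix (Fin m) (Fin k) ℝ} (hQ : Qᵀ * Q = 1) :
    mutualInfo μ X (select Q Y) ≠ ∞ ∧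
      (mutualInfo μ X (select Q Y)).toReal =
        1 / 2 * (Real.log (Qᵀ * dataCov G ΓX ΓYX * Q).det - Real.log (Qᵀ * ΓYX * Q).det) := by
  have hmeas {a b : ℕ} (A : Matrix (Fin a) (Fin b) ℝ) :
      Measurable (toEuclideanLin A : EuclideanSpace ℝ (Fin b) → EuclideanSpace ℝ (Fin a)) :=
    (LinearMap.continuous_of_finiteDimensional _).measurable
  have hΓY := posDef_dataCov G hΓX hΓYX
  have hGX : HasLaw (fun ω => toEuclideanLin G (X ω)) (multivariateGaussian 0 (G * ΓX * Gᵀ)) μ :=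
    ⟨(hmeas G).comp_aemeasurable hX.aemeasurable, by
      rw [← map_toEuclideanLin_multivariateGaussian hΓX.posSemidef, ← hX.map_eq,
        AEMeasurable.map_map_of_aemeasurable (hmeas G).aemeasurable hX.aemeasurable]
      rfl⟩
  have hYlaw : HasLaw Y (multivariateGaussian 0 (dataCov G ΓX ΓYX)) μ := by
    have hpsd := hΓX.posSemidef.mul_mul_conjTranspose_same G
    rw [conjTranspose_eq_transpose_of_trivial] at hpsd
    rw [show Y = fun ω => toEuclideanLin G (X ω) + ε ω from funext hY]
    exact map_add_multivariateGaussian hpsd hΓYX.posSemidef hGX hε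
      (hXε.comp (hmeas G) measurable_id)
  have hsel {V : Ω → EuclideanSpace ℝ (Fin m)} {S : Matrix (Fin m) (Fin m) ℝ} (hS : S.PosDef)
      (hV : HasLaw V (multivariateGaussian 0 S) μ) :
      μ.map (fun ω => toEuclideanLin Qᵀ (V ω)) = multivariateGaussian 0 (Qᵀ * S * Q) := by
    have h := map_toEuclideanLin_multivariateGaussian hS.posSemidef Qᵀ
    rw [transpose_transpose] at h
    rw [← h, ← hV.map_eq,
      AEMeasurable.map_map_of_aemeasurable (hmeas Qᵀ).aemeasurable hV.aemeasurable]
    rfl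
  obtain ⟨f, hf, hfd, hfi, hfint⟩ :=
    exists_logDensity_multivariateGaussian (posDef_transpose_mul_mul hΓYX hQ)
  obtain ⟨g, hg, hgd, hgi, hgint⟩ :=
    exists_logDensity_multivariateGaussian (posDef_transpose_mul_mul hΓY hQ)
  have hη := hsel hΓYX hε
  have hZ : μ.map (select Q Y) = _ := hsel hΓY hYlaw
  obtain ⟨hfin, heq⟩ := mutualInfo_add_noise μ (Z := select Q Y) hX.aemeasurable
    ((hmeas Qᵀ).comp_aemeasurable hε.aemeasurable) (hXε.comp measurable_id (hmeas Qᵀ))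
    ((hmeas Qᵀ).comp (hmeas G)) (fun ω => by simp [select, hY])
    hf hg (hη.trans hfd) (hZ.trans hgd) (by rw [Function.comp_def, hη]; exact hfi)
    (by rw [hZ]; exact hgi)
  refine ⟨hfin, heq.trans ?_⟩
  -- The standard Gaussian integral depends only on `k` and cancels, so it is never evaluated.
  rw [Function.comp_def, hη, hZ, hfint, hgint]
  ring

/-- The lower bound on the information carried by a selection of the data. -/
lemma halfTraceLog_sub_deviation_le {k : ℕ} (i : Fin k ↪ Fin m)
    {A Γ : Matrix (Fin m) (Fin m) ℝ} (hA : A.PosDef) (hΓ : Γ.PosDef) :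
    halfTraceLog (selectionOperator i) A Γ - deviation (selectionOperator i) Γ ≤
      1 / 2 * (Real.log ((selectionOperator i)ᵀ * A * selectionOperator i).det -
        Real.log ((selectionOperator i)ᵀ * Γ * selectionOperator i).det) := by
  have hQ := transpose_selectionOperator_mul_self i
  have h1 := trace_matLog_le_log_det hA hQ
  have h2 := log_det_le_sum_log_diag (posDef_transpose_mul_mul hΓ hQ)
  -- Selection keeps diagonal entries, so the bound in `h2` is exactly the trace of `log diag Γ`.
  have h3 : ((selectionOperator i)ᵀ * matLog (diagonal Γ.diag) * selectionOperator i).trace =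
      ∑ j, Real.log (((selectionOperator i)ᵀ * Γ * selectionOperator i) j j) := by
    rw [trace_selectionOperator, matLog_diagonal]
    simp [transpose_selectionOperator_mul_mul_apply]
  rw [deviation, halfTraceLog, halfTraceLog]
  simp only [Matrix.mul_sub, Matrix.sub_mul, trace_sub]
  linarith

lemma halfTraceLog_add_compl {k l : ℕ} (i : Fin k ↪ Fin m) (c : Fin l ↪ Fin m)
    (hc : IsCompl (Set.range i) (Set.range c))
    {A Γ : Matrix (Fin m) (Fin m) ℝ} (hA : A.PosDef) (hΓ : Γ.PosDef) :
    halfTraceLog (selectionOperator i) A Γ + halfTraceLog (selectionOperator c) A Γ =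
      1 / 2 * (Real.log A.det - Real.log Γ.det) := by
  rw [halfTraceLog, halfTraceLog, ← mul_add, trace_selectionOperator_add_compl i c hc, trace_sub,
    trace_matLog hA, trace_matLog hΓ]

lemma select_one {Ω : Type*} (Y : Ω → EuclideanSpace ℝ (Fin m)) : select 1 Y = Y := by
  ext ω
  simp [select]

end LinearGaussianDesign

theorem mainTheorem7 {Ω : Type*} [MeasurableSpace Ω] (μ : Measure Ω) [IsProbabilityMeasure μ]
    {m n : ℕ} (G : Matrix (Fin m) (Fin n) ℝ)
    (ΓX : Matrix (Fin n) (Fin n) ℝ) (hΓX : ΓX.PosDef)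
    (ΓYX : Matrix (Fin m) (Fin m) ℝ) (hΓYX : ΓYX.PosDef)
    (X : Ω → EuclideanSpace ℝ (Fin n)) (ε Y : Ω → EuclideanSpace ℝ (Fin m))
    (hX : HasLaw X (multivariateGaussian 0 ΓX) μ)
    (hε : HasLaw ε (multivariateGaussian 0 ΓYX) μ)
    (hXε : IndepFun X ε μ)
    (hY : ∀ ω, Y ω = Matrix.toEuclideanLin G (X ω) + ε ω)
    {k l : ℕ} (i : Fin k ↪ Fin m) (c : Fin l ↪ Fin m)
    (hc : IsCompl (Set.range i) (Set.range c))
    (P : Matrix (Fin m) (Fin k) ℝ) (hP : P = LinearGaussianDesign.selectionOperator i)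
    (Pc : Matrix (Fin m) (Fin l) ℝ) (hPc : Pc = LinearGaussianDesign.selectionOperator c)
    (ΓY : Matrix (Fin m) (Fin m) ℝ) (hΓY : ΓY = LinearGaussianDesign.dataCov G ΓX ΓYX) :
    -- the three mutual informations are finite
    (LinearGaussianDesign.mutualInfo μ X Y ≠ ∞ ∧
      LinearGaussianDesign.mutualInfo μ X (LinearGaussianDesign.select P Y) ≠ ∞ ∧
      LinearGaussianDesign.mutualInfo μ X (LinearGaussianDesign.select Pc Y) ≠ ∞) ∧
    -- the upper bound on the loss, for the operator `P`
    (LinearGaussianDesign.mutualInfo μ X Y).toReal -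
        (LinearGaussianDesign.mutualInfo μ X (LinearGaussianDesign.select Pc Y)).toReal ≤
      LinearGaussianDesign.halfTraceLog P ΓY ΓYX + LinearGaussianDesign.deviation Pc ΓYX ∧
    -- the lower bound on the information, for the operator `P`
    (LinearGaussianDesign.mutualInfo μ X (LinearGaussianDesign.select P Y)).toReal ≥
      LinearGaussianDesign.halfTraceLog P ΓY ΓYX - LinearGaussianDesign.deviation P ΓYX ∧
    -- the first bound for `P` is equivalent to the second bound for its complement
    ((LinearGaussianDesign.mutualInfo μ X Y).toReal -
        (LinearGaussianDesign.mutualInfo μ X (LinearGaussianDesign.select Pc Y)).toReal ≤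
      LinearGaussianDesign.halfTraceLog P ΓY ΓYX + LinearGaussianDesign.deviation Pc ΓYX ↔
    (LinearGaussianDesign.mutualInfo μ X (LinearGaussianDesign.select Pc Y)).toReal ≥
      LinearGaussianDesign.halfTraceLog Pc ΓY ΓYX - LinearGaussianDesign.deviation Pc ΓYX) := by
  subst hP hPc hΓY
  have hΓY := LinearGaussianDesign.posDef_dataCov G hΓX hΓYX
  obtain ⟨hfin, heq⟩ := LinearGaussianDesign.mutualInfo_select μ G hΓX hΓYX hX hε hXε hY
    (Q := (1 : Matrix (Fin m) (Fin m) ℝ)) (by simp)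
  obtain ⟨hfinP, heqP⟩ := LinearGaussianDesign.mutualInfo_select μ G hΓX hΓYX hX hε hXε hY
    (LinearGaussianDesign.transpose_selectionOperator_mul_self i)
  obtain ⟨hfinC, heqC⟩ := LinearGaussianDesign.mutualInfo_select μ G hΓX hΓYX hX hε hXε hY
    (LinearGaussianDesign.transpose_selectionOperator_mul_self c)
  rw [LinearGaussianDesign.select_one] at hfin heq
  simp only [Matrix.transpose_one, Matrix.one_mul, Matrix.mul_one] at heq
  have hsum := LinearGaussianDesign.halfTraceLog_add_compl i c hc hΓY hΓYX
  have hP := LinearGaussianDesign.halfTraceLog_sub_deviation_le i hΓY hΓYX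
  have hC := LinearGaussianDesign.halfTraceLog_sub_deviation_le c hΓY hΓYX
  rw [← heqP] at hP
  rw [← heqC] at hC
  rw [← heq] at hsum
  -- By `hsum`, the full information is the sum of the two half traces, so (1) is `hC` rearranged.
  refine ⟨⟨hfin, hfinP, hfinC⟩, by linarith, hP, fun h => by linarith, fun h => by linarith⟩
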